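/- Let $n\ge 0$ and let $Y\subseteq X\subseteq\mathbb P^n_{\mathbb Z}$ be closed, $X=V_+(I)$ and $Y=V_+(J)$ for homogeneous ideals $I\subseteq J$ of $\mathbb Z[X_0,\dots,X_n]$. Let $\|\cdot\|_1$ be a (continuous, for instance smooth) hermitian metric on $\mathcal O(1)|_{X(\mathbb C)}$ and let $\|\cdot\|$ be a (continuous, for instance smooth) hermitian metric on $\mathcal O(1)|_{X(\mathbb C)\setminus Y(\mathbb C)}$ with logarithmic singularities along $Y$, i.e. for every $y\in Y(\mathbb C)$, every $i$ with $y_i\neq 0$, and local generators $f_1,\dots,f_r$ of the ideal of $Y$ at $y$ (obtained by setting $X_i=1$ in generators of $J$) there are constants $c_1,c_2>0$ such that $$\max\bigl(\|X_i\|(x),\ \|X_i\|(x)^{-1}\bigr)\le c_1\,\bigl|\log\max_k|f_k(x)|\bigr|^{c_2}$$ for all $x\in X(\mathbb C)\setminus Y(\mathbb C)$ in a neighbourhood of $y$. For a number field $K$ with ring of integers $\mathcal O_K$ and $x\in X(K)\setminus Y(K)$, let $\rho:\operatorname{Spec}\mathcal O_K\to X$ be the corresponding morphism, let $P=\rho^*\mathcal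 O(1)$, with the norms $\|\cdot\|_\sigma$ (resp. $\|\cdot\|_{1,\sigma}$) induced on $P\otimes_\sigma\mathbb C$ by $\|\cdot\|$ (resp. $\|\cdot\|_1$) at $\sigma(x)$, for all embeddings $\sigma:K\hookrightarrow\mathbb C$, and put $$h(x)=\frac1{[K:\mathbb Q]}\Bigl(\log\#(P/\mathcal O_K p)-\sum_{\sigma}\log\|p\|_\sigma\Bigr)\qquad(0\ne p\in P),$$ and likewise $h_1(x)$ with $\|\cdot\|_{1,\sigma}$. These do not depend on $p$ or $K$ and define functions $h,h_1$ on $X(\overline{\mathbb Q})\setminus Y(\overline{\mathbb Q})$. Then there are constants $c_3,c_4>0$, depending only on $X$, $Y$ and the two metrics (in particular not on a number field of definition of $x$), such that for all $x\in X(\overline{\mathbb Q})\setminus Y(\overline{\mathbb Q})$ $$|h(x)-h_1(x)|\le c_3+c_4\log\max(1,h_1(x)).$$ -/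

import Mathlib

open scoped LinearAlgebra.Projectivization NumberField Topology
open MvPolynomial

namespace LogHeight

/-! ### Projective space, closed subschemes and their points -/

/-- The graded pieces of `ℤ[X₀, …, Xₙ]`, the homogeneous coordinate ring of `ℙⁿ` over `ℤ`. -/
abbrev grading (n : ℕ) : ℕ → Submodule ℤ (MvPolynomial (Fin (n + 1)) ℤ) :=
  homogeneousSubmodule (Fin (n + 1)) ℤ

noncomputable instance (n : ℕ) : GradedAlgebra (grading n) := MvPolynomial.gradedAlgebra

/-- `ℙⁿ(k)` for a field `k`: lines in `k^{n+1}`. -/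
abbrev Pt (k : Type*) [Field k] (n : ℕ) : Type _ := ℙ k (Fin (n + 1) → k)

/-- The `k`-valued points of the closed subscheme `V₊(I)` of `ℙⁿ` over `ℤ` cut out by the
homogeneous ideal `I`. -/
def points {n : ℕ} (I : HomogeneousIdeal (grading n)) (k : Type*) [Field k] : Set (Pt k n) :=
  {x | ∀ F ∈ I, aeval x.rep F = 0}

/-- The classical topology on `ℙⁿ(ℂ)`: the quotient topology from `ℂ^{n+1} ∖ {0}`. -/
instance (n : ℕ) : TopologicalSpace (Pt ℂ n) :=
  inferInstanceAs (TopologicalSpace (Quotient (projectivizationSetoid ℂ (Fin (n + 1) → ℂ))))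

/-- The affine coordinates `(x₀/xᵢ, …, xₙ/xᵢ)` of a point with `xᵢ ≠ 0`. -/
noncomputable def affineCoords {n : ℕ} (i : Fin (n + 1)) (x : Pt ℂ n) : Fin (n + 1) → ℂ :=
  fun j => x.rep j / x.rep i

/-! ### Hermitian metrics on `𝒪(1)` -/

/-- The fibre of `𝒪(1)` at `x`, i.e. the space of linear functionals on the line `x`. -/
abbrev Fibre {n : ℕ} (x : Pt ℂ n) : Type := Module.Dual ℂ x.submodule

/-- The value at `x` of the section `Xᵢ` of `𝒪(1)`. -/
noncomputable def coordSection {n : ℕ} (i : Fin (n + 1)) (x : Pt ℂ n) : Fibre x :=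
  (LinearMap.proj i : (Fin (n + 1) → ℂ) →ₗ[ℂ] ℂ) ∘ₗ x.submodule.subtype

/-- A (continuous) hermitian metric on the restriction of `𝒪(1)` to `U ⊆ ℙⁿ(ℂ)`: a norm on
every fibre over a point of `U`, such that the norms of the generating sections `X₀, …, Xₙ` are
continuous on `U`. (On a line, a norm satisfying `‖c • v‖ = |c| * ‖v‖` which is positive off `0` is
automatically given by a hermitian inner product. The values of `fibreNorm` at points outside `U`
carry no information and are never used.) -/
structure HermitianMetric (n : ℕ) (U : Set (Pt ℂ n)) where
  fibreNorm : ∀ x : Pt ℂ n, Fibre x → ℝ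
  fibreNorm_pos : ∀ x ∈ U, ∀ v : Fibre x, v ≠ 0 → 0 < fibreNorm x v
  fibreNorm_smul : ∀ x ∈ U, ∀ (c : ℂ) (v : Fibre x), fibreNorm x (c • v) = ‖c‖ * fibreNorm x v
  continuousOn_coordSection : ∀ i, ContinuousOn (fun x => fibreNorm x (coordSection i x)) U

/-- The metric `M` on `𝒪(1)|_{X(ℂ) ∖ Y(ℂ)}`, where `X = V₊(I)` and `Y = V₊(J)`, has logarithmic
singularities along `Y`: near every point `y ∈ Y(ℂ)`, in terms of a local frame `Xᵢ` of `𝒪(1)` and of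
local generators `f₁, …, f_r` of the ideal of `Y`, one has
`max (‖Xᵢ‖(x), ‖Xᵢ‖(x)⁻¹) ≤ c₁ * |log (max_k |f_k(x)|)| ^ c₂` on `X(ℂ) ∖ Y(ℂ)`.
The local generators are the dehomogenizations of generators of `J` with respect to `Xᵢ`. -/
def HasLogSingularities {n : ℕ} (I J : HomogeneousIdeal (grading n))
    (M : HermitianMetric n (points I ℂ \ points J ℂ)) : Prop :=
  ∀ y ∈ points J ℂ, ∀ i : Fin (n + 1), y.rep i ≠ 0 →
    ∀ (r : ℕ) (f : Fin r → MvPolynomial (Fin (n + 1)) ℤ),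
      Ideal.span (Set.range f) = J.toIdeal →
      ∃ c₁ c₂ : ℝ, 0 < c₁ ∧ 0 < c₂ ∧ ∀ᶠ x in 𝓝 y, x ∈ points I ℂ \ points J ℂ →
        max (M.fibreNorm x (coordSection i x)) (M.fibreNorm x (coordSection i x))⁻¹ ≤
          c₁ * |Real.log (⨆ k : Fin r, ‖aeval (affineCoords i x) (f k)‖)| ^ c₂

/-! ### Heights -/

section NumberField

variable {K : Type*} [Field K] {n : ℕ}

/-- The complex point `σ(x)` of `ℙⁿ`, for `x = [z₀ : … : zₙ]` with `zᵢ ∈ K` and `σ : K → ℂ`. -/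
noncomputable def conj (z : Fin (n + 1) → K) (hz : z ≠ 0) (σ : K →+* ℂ) : Pt ℂ n :=
  Projectivization.mk ℂ (σ ∘ z) fun h =>
    hz (funext fun i => σ.injective (by simpa using congrFun h i))

/-- The functional on the line spanned by `w` which maps `w` to `c`. -/
noncomputable def functional (w : Fin (n + 1) → ℂ) (hw : w ≠ 0) (c : ℂ) :
    Fibre (Projectivization.mk ℂ w hw) :=
  (c • (LinearEquiv.toSpanNonzeroSingleton ℂ (Fin (n + 1) → ℂ) w hw).symm.toLinearMap :
    Module.Dual ℂ (Submodule.span ℂ {w}))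

/-- Let `x = [z₀ : … : zₙ] ∈ ℙⁿ(K)` and let `ρ : Spec 𝓞_K → ℙⁿ` be the corresponding morphism.
Then `ρ^* 𝒪(1)` is the projective `𝓞_K`-module of rank one `∑ 𝓞_K zᵢ ⊆ K`, where the section
`∑ aᵢ Xᵢ` is pulled back to `∑ aᵢ zᵢ`. -/
def pullback (z : Fin (n + 1) → K) : Submodule (𝓞 K) K :=
  Submodule.span (𝓞 K) (Set.range z)

/-- The norm at the embedding `σ` on `ρ^* 𝒪(1)` induced by the metric `M`: the fibre of `𝒪(1)`
at `σ(x)` is `ρ^* 𝒪(1) ⊗_σ ℂ`, with `p ∈ ρ^* 𝒪(1) ⊆ K` corresponding to the functional which maps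
`σ(z)` to `σ(p)`. -/
noncomputable def pullbackNorm {U : Set (Pt ℂ n)} (M : HermitianMetric n U)
    (z : Fin (n + 1) → K) (hz : z ≠ 0) (σ : K →+* ℂ) (p : K) : ℝ :=
  M.fibreNorm (conj z hz σ) (functional (σ ∘ z) _ (σ p))

variable [NumberField K]

/-- The degree of a metrized line bundle on `Spec 𝓞_K`, given as a projective module `P ⊆ K` of
rank one together with norms `ν σ` for all embeddings `σ : K → ℂ`, computed with the nonzero
element `p ∈ P`: it is `log #(P / 𝓞_K p) - ∑_σ log ‖p‖_σ`. -/
noncomputable def arithDegree (P : Submodule (𝓞 K) K) (ν : (K →+* ℂ) → K → ℝ) (p : K) : ℝ :=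
  Real.log (Nat.card (P ⧸ (Submodule.span (𝓞 K) {p}).submoduleOf P)) - ∑ σ, Real.log (ν σ p)

/-- The height of `x = [z₀ : … : zₙ] ∈ ℙⁿ(K)`: the degree of the metrized line bundle `ρ^* 𝒪(1)`
divided by `[K : ℚ]`. -/
noncomputable def heightOver {U : Set (Pt ℂ n)} (M : HermitianMetric n U)
    (z : Fin (n + 1) → K) (hz : z ≠ 0) (p : K) : ℝ :=
  (Module.finrank ℚ K : ℝ)⁻¹ * arithDegree (pullback z) (pullbackNorm M z hz) p

end NumberField

/-- The algebraic numbers. -/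
abbrev QBar : Type := AlgebraicClosure ℚ

/-- The number field generated by a choice of homogeneous coordinates of `x ∈ ℙⁿ(ℚ̄)`. -/
noncomputable def coordField {n : ℕ} (x : Pt QBar n) : IntermediateField ℚ QBar :=
  IntermediateField.adjoin ℚ (Set.range x.rep)

instance {n : ℕ} (x : Pt QBar n) : NumberField (coordField x) where
  to_finiteDimensional := by
    have : Finite (Set.range x.rep) := Set.finite_range _
    exact IntermediateField.finiteDimensional_adjoin fun a _ =>
      (AlgebraicClosure.isAlgebraic ℚ).isAlgebraic a |>.isIntegral

/-- The homogeneous coordinates of `x`, as elements of `coordField x`. -/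
noncomputable def coords {n : ℕ} (x : Pt QBar n) : Fin (n + 1) → coordField x :=
  fun i => ⟨x.rep i, IntermediateField.subset_adjoin ℚ _ ⟨i, rfl⟩⟩

theorem coords_ne_zero {n : ℕ} (x : Pt QBar n) : coords x ≠ 0 := fun h =>
  x.rep_nonzero (funext fun i => congrArg Subtype.val (congrFun h i))

/-- A nonzero element of `ρ^* 𝒪(1)`, namely some nonzero coordinate of `x`. -/
noncomputable def nonzeroCoord {n : ℕ} (x : Pt QBar n) : coordField x :=
  coords x (Function.ne_iff.mp (coords_ne_zero x)).choose

/-- The height on `ℙⁿ(ℚ̄)` defined by the metric `M`, at the points whose conjugates all lie in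
the domain of `M`. It does not depend on the number field, the homogeneous coordinates and the
element of `ρ^* 𝒪(1)` that are used to compute it; see `height_eq_heightOver`. -/
noncomputable def HermitianMetric.height {n : ℕ} {U : Set (Pt ℂ n)} (M : HermitianMetric n U)
    (x : Pt QBar n) : ℝ :=
  heightOver M (coords x) (coords_ne_zero x) (nonzeroCoord x)

/-! ### Independence of choices -/

theorem mem_points_mk {n : ℕ} (I : HomogeneousIdeal (grading n)) {k : Type*} [Field k]
    (v : Fin (n + 1) → k) (hv : v ≠ 0) :
    Projectivization.mk k v hv ∈ points I k ↔ ∀ F ∈ I, aeval v F = 0 := by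
  have hom : ∀ (w : Fin (n + 1) → k) (c : k) (d : ℕ) (F : MvPolynomial (Fin (n + 1)) ℤ),
      F.IsHomogeneous d → aeval (c • w) F = c ^ d * aeval w F := by
    intro w c d F hF
    rw [aeval_def, aeval_def, eval₂_eq', eval₂_eq', Finset.mul_sum]
    refine Finset.sum_congr rfl fun e he => ?_
    have hd : ∑ i, e i = d := by
      have := hF (mem_support_iff.1 he)
      rwa [Finsupp.weight_apply, Finsupp.sum_fintype _ _ (by simp), Finset.sum_congr rfl
        fun i _ => by rw [Pi.one_apply, smul_eq_mul, mul_one]] at this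
    simp only [Pi.smul_apply, smul_eq_mul, mul_pow, Finset.prod_mul_distrib,
      Finset.prod_pow_eq_pow_sum, hd]
    ring
  have key : ∀ (w : Fin (n + 1) → k) (c : k), (∀ F ∈ I, aeval w F = 0) →
      ∀ F ∈ I, aeval (c • w) F = 0 := by
    intro w c h F hF
    rw [← sum_homogeneousComponent F, map_sum]
    refine Finset.sum_eq_zero fun d _ => ?_
    have hd : homogeneousComponent d F ∈ I :=
      homogeneousComponent_mem_of_mem I.isHomogeneous hF d
    rw [hom _ _ d _ (homogeneousComponent_isHomogeneous d F), h _ hd, mul_zero]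
  obtain ⟨a, ha⟩ := Projectivization.exists_smul_eq_mk_rep k v hv
  constructor
  · intro h
    have : v = (↑a⁻¹ : k) • (Projectivization.mk k v hv).rep := by
      rw [← ha, Units.smul_def, smul_smul, Units.inv_mul, one_smul]
    rw [this]
    exact key _ _ h
  · intro h
    change ∀ F ∈ I, aeval (Projectivization.mk k v hv).rep F = 0
    rw [← ha, Units.smul_def]
    exact key _ _ h

theorem conj_mem_points {n : ℕ} (I : HomogeneousIdeal (grading n)) {K L : Type*} [Field K]
    [Field L] (τ : K →+* L) (σ : K →+* ℂ) (z : Fin (n + 1) → K) (hz : z ≠ 0)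
    (hz' : τ ∘ z ≠ 0) :
    conj z hz σ ∈ points I ℂ ↔ Projectivization.mk L (τ ∘ z) hz' ∈ points I L := by
  have k1 : ∀ F : MvPolynomial (Fin (n + 1)) ℤ, aeval (τ ∘ z) F = τ (aeval z F) := fun F => by
    rw [aeval_def, aeval_def, eval₂_comp_left]
    congr 1
    exact RingHom.ext_int _ _
  have k2 : ∀ F : MvPolynomial (Fin (n + 1)) ℤ, aeval (σ ∘ z) F = σ (aeval z F) := fun F => by
    rw [aeval_def, aeval_def, eval₂_comp_left]
    congr 1
    exact RingHom.ext_int _ _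
  rw [conj, mem_points_mk, mem_points_mk]
  simp only [k1, k2, map_eq_zero]

section Independence

variable {K : Type*} [Field K] {n : ℕ}

theorem functional_apply (w : Fin (n + 1) → ℂ) (hw : w ≠ 0) (c t : ℂ)
    (ht : t • w ∈ (Projectivization.mk ℂ w hw).submodule) :
    functional w hw c ⟨t • w, ht⟩ = c * t := by
  change c * (LinearEquiv.toSpanNonzeroSingleton ℂ (Fin (n + 1) → ℂ) w hw).symm
    (LinearEquiv.toSpanNonzeroSingleton ℂ (Fin (n + 1) → ℂ) w hw t) = c * t
  rw [LinearEquiv.symm_apply_apply]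

theorem functional_eq_smul (w : Fin (n + 1) → ℂ) (hw : w ≠ 0) (c : ℂ) :
    functional w hw c = c • functional w hw 1 := by
  ext ⟨v, hv⟩
  obtain ⟨t, rfl⟩ := Submodule.mem_span_singleton.1 hv
  rw [LinearMap.smul_apply, functional_apply, functional_apply, one_mul, smul_eq_mul]

theorem functional_ne_zero (w : Fin (n + 1) → ℂ) (hw : w ≠ 0) : functional w hw 1 ≠ 0 := by
  intro h
  have h1 := functional_apply w hw 1 1 (Submodule.mem_span_singleton.2 ⟨1, rfl⟩)
  rw [h, one_mul] at h1
  exact zero_ne_one h1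

theorem fibreNorm_functional_smul {U : Set (Pt ℂ n)} (M : HermitianMetric n U)
    (w w' : Fin (n + 1) → ℂ) (hw : w ≠ 0) (hw' : w' ≠ 0) (l c c' : ℂ) (hl : w' = l • w)
    (hc : c' = l * c) :
    M.fibreNorm _ (functional w' hw' c') = M.fibreNorm _ (functional w hw c) := by
  have hl0 : l ≠ 0 := fun h => hw' (by rw [hl, h, zero_smul])
  have gen : ∀ (x y : Pt ℂ n) (φ : Fibre x) (ψ : Fibre y), x = y →
      (∀ v hx hy, φ ⟨v, hx⟩ = ψ ⟨v, hy⟩) → M.fibreNorm x φ = M.fibreNorm y ψ := by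
    rintro x y φ ψ rfl h
    congr 1
    ext ⟨v, hv⟩
    exact h v hv hv
  refine gen _ _ _ _ ((Projectivization.mk_eq_mk_iff' ℂ _ _ _ _).2 ⟨l, hl.symm⟩) ?_
  intro v hx hy
  obtain ⟨t, rfl⟩ := Submodule.mem_span_singleton.1 hx
  rw [functional_apply]
  have : t • w' = (t * l) • w := by rw [hl, smul_smul]
  have h2 : (⟨t • w', hy⟩ : (Projectivization.mk ℂ w hw).submodule) =
      ⟨(t * l) • w, this ▸ hy⟩ := Subtype.ext this
  rw [h2, functional_apply, hc]
  ring

theorem pullbackNorm_eq {U : Set (Pt ℂ n)} (M : HermitianMetric n U)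
    (z : Fin (n + 1) → K) (hz : z ≠ 0) (σ : K →+* ℂ) (hσ : conj z hz σ ∈ U) (p : K) :
    pullbackNorm M z hz σ p = ‖σ p‖ * pullbackNorm M z hz σ 1 := by
  unfold pullbackNorm
  rw [functional_eq_smul, map_one]
  exact M.fibreNorm_smul _ hσ _ _

variable [NumberField K]

theorem sum_log_embeddings (b : 𝓞 K) :
    Real.log (Ideal.absNorm (Ideal.span {b})) = ∑ σ : K →+* ℂ, Real.log ‖σ b‖ := by
  by_cases hb : b = 0
  · simp [hb]
  have h1 : ((Ideal.absNorm (Ideal.span {b}) : ℕ) : ℝ) = ∏ σ : K →+* ℂ, ‖σ b‖ := by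
    have h := congrArg (‖·‖) (Algebra.norm_eq_prod_embeddings ℚ ℂ (b : K))
    simp only [norm_prod] at h
    rw [← Fintype.prod_equiv (RingHom.equivRatAlgHom K ℂ) (fun f => ‖f b‖)
      (fun φ => ‖φ b‖) fun _ => by simp [RingHom.equivRatAlgHom_apply]] at h
    rw [← h, Ideal.absNorm_span_singleton, ← Algebra.coe_norm_int]
    simp [Nat.cast_natAbs]
  rw [h1, Real.log_prod]
  intro σ _
  simpa using hb

theorem card_quotient_mul (z : Fin (n + 1) → K) (a : Fin (n + 1) → 𝓞 K) (m : 𝓞 K) (hm : m ≠ 0)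
    (ha : ∀ i, (a i : K) = m * z i) (p : K) (hp : p ∈ pullback z) :
    ∃ b : 𝓞 K, (b : K) = m * p ∧
      Nat.card (pullback z ⧸ (Submodule.span (𝓞 K) {p}).submoduleOf (pullback z)) *
        Ideal.absNorm (Ideal.span (Set.range a)) = Ideal.absNorm (Ideal.span {b}) := by
  have hmK : (m : K) ≠ 0 := by simpa using hm
  let f : K →ₗ[𝓞 K] K := LinearMap.mulLeft (𝓞 K) (m : K)
  have hf : Function.Injective f := fun x y h => mul_left_cancel₀ hmK h
  let g : 𝓞 K →ₗ[𝓞 K] K := Algebra.linearMap (𝓞 K) K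
  have hg : Function.Injective g := FaithfulSMul.algebraMap_injective (𝓞 K) K
  have hP : (pullback z).map f = Submodule.map g (Ideal.span (Set.range a)) := by
    rw [pullback, Submodule.map_span, Ideal.span, Submodule.map_span, ← Set.range_comp,
      ← Set.range_comp]
    congr 2
    ext i
    exact (ha i).symm
  obtain ⟨b, hbI, hb⟩ : f p ∈ Submodule.map g (Ideal.span (Set.range a)) :=
    hP ▸ Submodule.mem_map_of_mem hp
  refine ⟨b, hb, ?_⟩
  have hQ : (Submodule.span (𝓞 K) {p}).map f = Submodule.map g (Ideal.span {b}) := by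
    rw [Submodule.map_span, Ideal.span, Submodule.map_span, Set.image_singleton,
      Set.image_singleton, hb]
  have hle : (Ideal.span {b}).toAddSubgroup ≤ (Ideal.span (Set.range a)).toAddSubgroup := by
    change Ideal.span {b} ≤ Ideal.span (Set.range a)
    rwa [Ideal.span_singleton_le_iff_mem]
  have hcard : Nat.card (pullback z ⧸ (Submodule.span (𝓞 K) {p}).submoduleOf (pullback z)) =
      (Submodule.span (𝓞 K) {p}).toAddSubgroup.relIndex (pullback z).toAddSubgroup := rfl
  have m1 : ∀ (A : Submodule (𝓞 K) K), (A.map f).toAddSubgroup =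
      A.toAddSubgroup.map f.toAddMonoidHom := fun A => rfl
  have m2 : ∀ (A : Ideal (𝓞 K)), (Submodule.map g A).toAddSubgroup =
      A.toAddSubgroup.map g.toAddMonoidHom := fun A => rfl
  rw [hcard, ← AddSubgroup.relIndex_map_map_of_injective _ _ (f := f.toAddMonoidHom) hf, ← m1,
    ← m1, hP, hQ, m2, m2, AddSubgroup.relIndex_map_map_of_injective _ _ hg]
  exact AddSubgroup.relIndex_mul_index hle

theorem heightOver_formula {U : Set (Pt ℂ n)} (M : HermitianMetric n U) (z : Fin (n + 1) → K)
    (hz : z ≠ 0) (hU : ∀ σ, conj z hz σ ∈ U) (a : Fin (n + 1) → 𝓞 K) (m : 𝓞 K) (hm : m ≠ 0)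
    (ha : ∀ i, (a i : K) = m * z i) (p : K) (hp : p ∈ pullback z) (hp0 : p ≠ 0) :
    heightOver M z hz p = (Module.finrank ℚ K : ℝ)⁻¹ *
      (∑ σ : K →+* ℂ, Real.log ‖σ m‖ - Real.log (Ideal.absNorm (Ideal.span (Set.range a))) -
        ∑ σ, Real.log (pullbackNorm M z hz σ 1)) := by
  obtain ⟨b, hb, hcard⟩ := card_quotient_mul z a m hm ha p hp
  have hmK : (m : K) ≠ 0 := by simpa using hm
  have hb0 : b ≠ 0 := by
    rintro rfl
    simp [hmK, hp0] at hb
  have hN : ((Ideal.absNorm (Ideal.span {b}) : ℕ) : ℝ) ≠ 0 := by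
    simpa [Ideal.absNorm_eq_zero_iff] using hb0
  have hlog := congrArg (fun t : ℕ => Real.log t) hcard
  rw [← hcard] at hN
  push_cast at hN
  simp only [Nat.cast_mul] at hlog
  rw [Real.log_mul (left_ne_zero_of_mul hN) (right_ne_zero_of_mul hN), sum_log_embeddings, hb]
    at hlog
  have h1 : ∀ σ : K →+* ℂ, Real.log ‖σ (m * p)‖ = Real.log ‖σ m‖ + Real.log ‖σ p‖ := fun σ => by
    rw [map_mul, norm_mul, Real.log_mul] <;> simp [hm, hp0]
  have h2 : ∀ σ : K →+* ℂ, Real.log (pullbackNorm M z hz σ p) =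
      Real.log ‖σ p‖ + Real.log (pullbackNorm M z hz σ 1) := fun σ => by
    rw [pullbackNorm_eq M z hz σ (hU σ), Real.log_mul]
    · simp [hp0]
    · refine (M.fibreNorm_pos _ (hU σ) _ ?_).ne'
      rw [map_one]
      exact functional_ne_zero _ _
  rw [heightOver, arithDegree]
  simp only [h1, h2, Finset.sum_add_distrib] at hlog ⊢
  congr 1
  linarith

theorem exists_integral_multiple (z : Fin (n + 1) → K) :
    ∃ (m : 𝓞 K) (a : Fin (n + 1) → 𝓞 K), m ≠ 0 ∧ ∀ i, (a i : K) = m * z i := by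
  obtain ⟨m, hm⟩ := IsLocalization.exist_integer_multiples_of_finite (nonZeroDivisors (𝓞 K)) z
  choose a ha using hm
  exact ⟨m, a, nonZeroDivisors.coe_ne_zero m, fun i => (ha i).trans (Algebra.smul_def _ _)⟩

theorem heightOver_smul {U : Set (Pt ℂ n)} (M : HermitianMetric n U) (z z' : Fin (n + 1) → K)
    (hz : z ≠ 0) (hz' : z' ≠ 0) (hU : ∀ σ, conj z hz σ ∈ U) (l : K) (hl : z' = l • z)
    (p p' : K) (hp : p ∈ pullback z) (hp0 : p ≠ 0) (hp' : p' ∈ pullback z') (hp0' : p' ≠ 0) :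
    heightOver M z' hz' p' = heightOver M z hz p := by
  have hl0 : l ≠ 0 := fun h => hz' (by rw [hl, h, zero_smul])
  have hc : ∀ σ, conj z' hz' σ = conj z hz σ := fun σ =>
    (Projectivization.mk_eq_mk_iff' ℂ _ _ _ _).2 ⟨σ l, by ext i; simp [hl]⟩
  obtain ⟨m, a, hm, ha⟩ := exists_integral_multiple z'
  have hU' : ∀ σ, conj z' hz' σ ∈ U := fun σ => hc σ ▸ hU σ
  have hmem : l * p ∈ pullback z' := by
    have : (pullback z).map (LinearMap.mulLeft (𝓞 K) l) = pullback z' := by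
      rw [pullback, Submodule.map_span, ← Set.range_comp, pullback, hl]
      rfl
    rw [← this]
    exact Submodule.mem_map_of_mem hp
  rw [heightOver_formula M z' hz' hU' a m hm ha p' hp' hp0',
    ← heightOver_formula M z' hz' hU' a m hm ha (l * p) hmem (mul_ne_zero hl0 hp0)]
  rw [heightOver, heightOver, arithDegree, arithDegree]
  congr 2
  · let f : K →ₗ[𝓞 K] K := LinearMap.mulLeft (𝓞 K) l
    have hf : Function.Injective f := fun x y h => mul_left_cancel₀ hl0 h
    have hP : (pullback z).map f = pullback z' := by
      rw [pullback, Submodule.map_span, ← Set.range_comp, pullback, hl]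
      rfl
    have hQ : (Submodule.span (𝓞 K) {p}).map f = Submodule.span (𝓞 K) {l * p} := by
      rw [Submodule.map_span, Set.image_singleton]
      rfl
    rw [← hP, ← hQ]
    congr 2
    exact AddSubgroup.relIndex_map_map_of_injective (Submodule.span (𝓞 K) {p}).toAddSubgroup
      (pullback z).toAddSubgroup (f := f.toAddMonoidHom) hf
  · refine Finset.sum_congr rfl fun σ _ => congrArg Real.log ?_
    refine fibreNorm_functional_smul M _ _ _ _ (σ l) _ _ ?_ (map_mul σ l p)
    ext i
    simp [hl]

theorem sum_embeddings_comp (E : Type*) [Field E] [NumberField E] [Algebra K E]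
    (F : (K →+* ℂ) → ℝ) :
    ∑ τ : E →+* ℂ, F (τ.comp (algebraMap K E)) = Module.finrank K E * ∑ σ, F σ := by
  classical
  rw [← Finset.sum_fiberwise Finset.univ (fun τ : E →+* ℂ => τ.comp (algebraMap K E)),
    Finset.mul_sum]
  refine Finset.sum_congr rfl fun σ _ => ?_
  rw [Finset.sum_congr rfl (g := fun _ => F σ)
    fun τ hτ => by rw [(Finset.mem_filter.1 hτ).2], Finset.sum_const, nsmul_eq_mul]
  congr 2
  let := σ.toAlgebra
  rw [← AlgHom.card K E ℂ]
  refine (Fintype.card_of_subtype (p := fun τ : E →+* ℂ => τ.comp (algebraMap K E) = σ) _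
    ?_).symm.trans (Fintype.card_congr ?_)
  · simp
  · exact
      { toFun := fun τ => { τ.1 with commutes' := fun r => RingHom.congr_fun τ.2 r }
        invFun := fun τ => ⟨τ.toRingHom, RingHom.ext fun r => τ.commutes r⟩
        left_inv := fun _ => rfl
        right_inv := fun _ => rfl }

theorem absNorm_span_comp (E : Type*) [Field E] [NumberField E] [Algebra K E]
    (a : Fin (n + 1) → 𝓞 K) :
    Ideal.absNorm (Ideal.span (Set.range (algebraMap (𝓞 K) (𝓞 E) ∘ a))) =
      Ideal.absNorm (Ideal.span (Set.range a)) ^ Module.finrank K E := by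
  have h : Ideal.span (Set.range (algebraMap (𝓞 K) (𝓞 E) ∘ a)) =
      (Ideal.span (Set.range a)).map (algebraMap (𝓞 K) (𝓞 E)) := by
    rw [Ideal.map_span, ← Set.range_comp]
  rw [h, Ideal.absNorm_algebraMap, ← IsFractionRing.finrank_eq (𝓞 K) K (𝓞 E) E]

theorem exists_extension {L E : Type*} [Field L] [Field E] [NumberField L] [NumberField E]
    (i : L →+* E) (σ : L →+* ℂ) : ∃ τ : E →+* ℂ, ∀ r, τ (i r) = σ r := by
  let := i.toAlgebra
  let := σ.toAlgebra
  have : Algebra.IsAlgebraic L E := Algebra.IsAlgebraic.tower_top (K := ℚ) L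
  let τ : E →ₐ[L] ℂ := IsAlgClosed.lift
  exact ⟨τ.toRingHom, fun r => τ.commutes r⟩

theorem heightOver_baseChange {U : Set (Pt ℂ n)} (M : HermitianMetric n U) (E : Type*) [Field E]
    [NumberField E] [Algebra K E] (z : Fin (n + 1) → K) (hz : z ≠ 0)
    (hz' : algebraMap K E ∘ z ≠ 0) (hU : ∀ σ, conj z hz σ ∈ U) (p : K) (hp : p ∈ pullback z)
    (hp0 : p ≠ 0) :
    algebraMap K E p ∈ pullback (algebraMap K E ∘ z) ∧
      heightOver M (algebraMap K E ∘ z) hz' (algebraMap K E p) = heightOver M z hz p := by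
  have hmem : algebraMap K E p ∈ pullback (algebraMap K E ∘ z) := by
    refine Submodule.span_induction (p := fun x _ => algebraMap K E x ∈
      pullback (algebraMap K E ∘ z)) ?_ ?_ ?_ ?_ hp
    · rintro _ ⟨i, rfl⟩
      exact Submodule.subset_span ⟨i, rfl⟩
    · simp
    · intro x y _ _ hx hy
      rw [map_add]
      exact add_mem hx hy
    · intro r x _ hx
      have : algebraMap K E (r • x) = algebraMap (𝓞 K) (𝓞 E) r • algebraMap K E x := by
        rw [Algebra.smul_def, Algebra.smul_def, map_mul]
        rfl
      rw [this]
      exact Submodule.smul_mem _ _ hx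
  refine ⟨hmem, ?_⟩
  obtain ⟨m, a, hm, ha⟩ := exists_integral_multiple z
  have hcomp : ∀ τ : E →+* ℂ, conj (algebraMap K E ∘ z) hz' τ =
      conj z hz (τ.comp (algebraMap K E)) := fun τ => rfl
  have hm' : algebraMap (𝓞 K) (𝓞 E) m ≠ 0 := fun h =>
    hm (FaithfulSMul.algebraMap_injective (𝓞 K) (𝓞 E) (h.trans (map_zero _).symm))
  have hp0' : algebraMap K E p ≠ 0 := (map_ne_zero _).2 hp0
  have hU' : ∀ τ : E →+* ℂ, conj (algebraMap K E ∘ z) hz' τ ∈ U := fun τ => hcomp τ ▸ hU _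
  have ha' : ∀ i, (((algebraMap (𝓞 K) (𝓞 E) ∘ a) i : 𝓞 E) : E) =
      (algebraMap (𝓞 K) (𝓞 E) m : 𝓞 E) * (algebraMap K E ∘ z) i := by
    intro i
    change algebraMap K E (a i) = algebraMap K E m * algebraMap K E (z i)
    rw [ha, map_mul]
  have f1 := heightOver_formula M z hz hU a m hm ha p hp hp0
  have f2 := heightOver_formula M (algebraMap K E ∘ z) hz' hU' _ _ hm' ha' _ hmem hp0'
  rw [f1, f2]
  · have e1 : ∑ τ : E →+* ℂ, Real.log ‖τ (algebraMap (𝓞 K) (𝓞 E) m : 𝓞 E)‖ =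
        Module.finrank K E * ∑ σ : K →+* ℂ, Real.log ‖σ m‖ := by
      have hτ : ∀ τ : E →+* ℂ, τ (algebraMap (𝓞 K) (𝓞 E) m : 𝓞 E) =
        (τ.comp (algebraMap K E)) (m : K) := fun τ => rfl
      simp only [hτ]
      exact sum_embeddings_comp E fun σ => Real.log ‖σ (m : K)‖
    have e2 : ∑ τ : E →+* ℂ, Real.log (pullbackNorm M (algebraMap K E ∘ z) hz' τ 1) =
        Module.finrank K E * ∑ σ : K →+* ℂ, Real.log (pullbackNorm M z hz σ 1) := by
      rw [← sum_embeddings_comp E fun σ => Real.log (pullbackNorm M z hz σ 1)]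
      refine Finset.sum_congr rfl fun τ _ => ?_
      unfold pullbackNorm
      simp only [map_one]
      rfl
    have e3 : Real.log (Ideal.absNorm (Ideal.span (Set.range (algebraMap (𝓞 K) (𝓞 E) ∘ a)))) =
        Module.finrank K E * Real.log (Ideal.absNorm (Ideal.span (Set.range a))) := by
      rw [absNorm_span_comp, Nat.cast_pow, Real.log_pow]
    have hfr : (Module.finrank ℚ E : ℝ) = Module.finrank ℚ K * Module.finrank K E := by
      rw [← Nat.cast_mul, Module.finrank_mul_finrank]
    have h0 : (Module.finrank K E : ℝ) ≠ 0 := by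
      have : Module.Finite K E := Module.Finite.of_restrictScalars_finite ℚ K E
      exact_mod_cast Module.finrank_pos.ne'
    rw [e1, e2, e3, hfr, mul_inv]
    field_simp

end Independence

/-- The height of `x ∈ ℙⁿ(ℚ̄)` can be computed over every number field `L ⊆ ℚ̄` over which `x` is
defined, with any homogeneous coordinates of `x` in `L`, and any nonzero element `p` of
`ρ^* 𝒪(1)`. -/
theorem height_eq_heightOver {n : ℕ} {U : Set (Pt ℂ n)} (M : HermitianMetric n U) (x : Pt QBar n)
    (hx : ∀ σ, conj (coords x) (coords_ne_zero x) σ ∈ U)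
    (L : IntermediateField ℚ QBar) [NumberField L] (z : Fin (n + 1) → L) (hz : z ≠ 0)
    (l : QBar) (hl : ∀ i, (z i : QBar) = l * x.rep i) (p : L) (hp : p ∈ pullback z)
    (hp0 : p ≠ 0) : M.height x = heightOver M z hz p := by
  let A := coordField x
  let E : IntermediateField ℚ QBar := A ⊔ L
  have hfd : FiniteDimensional ℚ A := NumberField.to_finiteDimensional
  have hfd' : FiniteDimensional ℚ L := NumberField.to_finiteDimensional
  have : FiniteDimensional ℚ E := IntermediateField.finiteDimensional_sup A L
  have : NumberField E := { to_charZero := inferInstance, to_finiteDimensional := this }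
  let iA : A →+* E := (IntermediateField.inclusion (le_sup_left : A ≤ E)).toRingHom
  let iL : L →+* E := (IntermediateField.inclusion (le_sup_right : L ≤ E)).toRingHom
  have hcA : iA ∘ coords x ≠ 0 := fun h => coords_ne_zero x
    (funext fun i => iA.injective (by simpa using congrFun h i))
  have hcL : iL ∘ z ≠ 0 := fun h => hz
    (funext fun i => iL.injective (by simpa using congrFun h i))
  have hnA : nonzeroCoord x ≠ 0 := (Function.ne_iff.mp (coords_ne_zero x)).choose_spec
  have hmA : nonzeroCoord x ∈ pullback (coords x) := Submodule.subset_span ⟨_, rfl⟩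
  obtain ⟨i, hi⟩ := Function.ne_iff.mp (coords_ne_zero x)
  have hi' : iA (coords x i) ≠ 0 := by simpa using hi
  have hprop : iL ∘ z = (iL (z i) / iA (coords x i)) • (iA ∘ coords x) := by
    funext j
    have hv : ∀ j, ((iL (z j) : E) : QBar) = l * ((iA (coords x j) : E) : QBar) := hl
    have hi2 : ((iA (coords x i) : E) : QBar) ≠ 0 := by exact_mod_cast hi'
    apply Subtype.ext
    simp only [Function.comp_apply, Pi.smul_apply, smul_eq_mul]
    push_cast
    rw [hv j, hv i]
    field_simp
  have hxE : ∀ σ : E →+* ℂ, conj (iA ∘ coords x) hcA σ ∈ U := fun σ => hx (σ.comp iA)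
  have hxL : ∀ σ : L →+* ℂ, conj z hz σ ∈ U := by
    intro σ
    obtain ⟨τ, hτ⟩ := exists_extension iL σ
    have h1 : conj z hz σ = conj (iA ∘ coords x) hcA τ := by
      refine (Projectivization.mk_eq_mk_iff' ℂ _ _ _ _).2
        ⟨τ (iL (z i) / iA (coords x i)), ?_⟩
      funext j
      have h2 : σ (z j) = τ ((iL ∘ z) j) := (hτ (z j)).symm
      rw [Function.comp_apply, h2, hprop]
      simp
    rw [h1]
    exact hxE _
  have bA : iA (nonzeroCoord x) ∈ pullback (iA ∘ coords x) ∧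
      heightOver M (iA ∘ coords x) hcA (iA (nonzeroCoord x)) = M.height x := by
    let := iA.toAlgebra
    exact heightOver_baseChange M E (coords x) (coords_ne_zero x) hcA hx _ hmA hnA
  have bL : iL p ∈ pullback (iL ∘ z) ∧
      heightOver M (iL ∘ z) hcL (iL p) = heightOver M z hz p := by
    let := iL.toAlgebra
    exact heightOver_baseChange M E z hz hcL hxL _ hp hp0
  rw [← bA.2, ← bL.2]
  exact (heightOver_smul M _ _ hcA hcL hxE _ hprop _ _ bA.1 (by simpa using hnA) bL.1
    (by simpa using hp0)).symm

/-- For a point `x` of `X(ℚ̄) ∖ Y(ℚ̄)` all conjugates lie in `X(ℂ) ∖ Y(ℂ)`, so that the heights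
defined by metrics on `𝒪(1)|_{X(ℂ) ∖ Y(ℂ)}` are well defined on `X(ℚ̄) ∖ Y(ℚ̄)`. -/
theorem conj_coords_mem_points {n : ℕ} (I : HomogeneousIdeal (grading n)) (x : Pt QBar n)
    (σ : coordField x →+* ℂ) :
    conj (coords x) (coords_ne_zero x) σ ∈ points I ℂ ↔ x ∈ points I QBar := by
  have h := conj_mem_points I (coordField x).val.toRingHom σ (coords x) (coords_ne_zero x)
    x.rep_nonzero
  refine h.trans ?_
  conv_rhs => rw [← x.mk_rep]
  rfl

end LogHeight

namespace LogHeight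

/-! ### Homogeneous polynomials -/

/-! The finite places contribute the same amount to `h` and `h₁`, so `h - h₁` is the average over
the embeddings `σ` of a local error, the logarithm of the quotient of the two norms at `σ(x)`. This
error is unbounded only near `Y`. There it is of the order `log (-log |F(v_σ)|)`, where `F` is one
of finitely many homogeneous generators of `J`, chosen with `F(x) ≠ 0`, and `v_σ` is a
representative of `σ(x)` of norm one. By compactness of the cone over `X(ℂ)` in the unit sphere, the
error is at most `A + c * log (A - log |F(v_σ)|)` with `A`, `c` independent of `σ` and `x`
(`exists_log_bound`).

The bound at a single place can be arbitrarily bad, but only the average matters. Since `log` is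
concave, Jensen's inequality moves the average inside (`sum_log_div_card_le`), and it remains to
bound the mean of `-log |F(v_σ)|` linearly in `h₁(x)`.

This is a Liouville estimate: for integral coordinates `a` of `x` and `D = deg F`, the nonzero
integer `F(a)` lies in the `D`-th power of the ideal generated by `a`, so its norm is at least the
`D`-th power of the norm of that ideal (`mul_log_absNorm_le_sum`). Rewritten with `v_σ`, the mean of
`-log |F(v_σ)|` is at most `D * (h₁(x) + C)`, where `C` bounds the logarithm of the continuous
metric on the unit cone. All terms are normalized by `[K : ℚ]`, hence the uniformity in `K`
(`abs_heightOver_sub_le`). -/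

theorem sum_eq_of_mem_support {R ι : Type*} [CommSemiring R] [Fintype ι] {F : MvPolynomial ι R}
    {d : ℕ} (hF : F.IsHomogeneous d) {e : ι →₀ ℕ} (he : e ∈ F.support) : ∑ i, e i = d := by
  have := hF (mem_support_iff.1 he)
  rwa [Finsupp.weight_apply, Finsupp.sum_fintype _ _ (by simp), Finset.sum_congr rfl
    fun i _ => by rw [Pi.one_apply, smul_eq_mul, mul_one]] at this

theorem aeval_smul_of_isHomogeneous {ι k : Type*} [Fintype ι] [CommRing k]
    {F : MvPolynomial ι ℤ} {d : ℕ} (hF : F.IsHomogeneous d) (c : k) (w : ι → k) :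
    aeval (c • w) F = c ^ d * aeval w F := by
  rw [aeval_def, aeval_def, eval₂_eq', eval₂_eq', Finset.mul_sum]
  refine Finset.sum_congr rfl fun e he => ?_
  simp only [Pi.smul_apply, smul_eq_mul, mul_pow, Finset.prod_mul_distrib,
    Finset.prod_pow_eq_pow_sum, sum_eq_of_mem_support hF he]
  ring

theorem aeval_comp_ringHom {ι k l : Type*} [CommRing k] [CommRing l] (σ : k →+* l) (w : ι → k)
    (F : MvPolynomial ι ℤ) : aeval (σ ∘ w) F = σ (aeval w F) := by
  rw [aeval_def, aeval_def, eval₂_comp_left]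
  congr 1
  exact RingHom.ext_int _ _

theorem aeval_mem_span_pow {ι R : Type*} [Fintype ι] [CommRing R] {F : MvPolynomial ι ℤ} {d : ℕ}
    (hF : F.IsHomogeneous d) (a : ι → R) : aeval a F ∈ Ideal.span (Set.range a) ^ d := by
  rw [aeval_def, eval₂_eq']
  refine Ideal.sum_mem _ fun e he => Ideal.mul_mem_left _ _ ?_
  rw [← sum_eq_of_mem_support hF he, ← Finset.prod_pow_eq_pow_sum]
  exact Ideal.prod_mem_prod fun i _ =>
    Ideal.pow_mem_pow (Ideal.subset_span (Set.mem_range_self i)) _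

/-- A homogeneous ideal of `ℤ[X₀, …, Xₙ]` has a finite family of homogeneous generators. -/
theorem exists_homogeneous_generators {n : ℕ} (J : HomogeneousIdeal (grading n)) :
    ∃ (r : ℕ) (F : Fin r → MvPolynomial (Fin (n + 1)) ℤ) (D : Fin r → ℕ),
      Ideal.span (Set.range F) = J.toIdeal ∧ ∀ k, (F k).IsHomogeneous (D k) := by
  obtain ⟨S, hS⟩ := (Ideal.IsHomogeneous.iff_exists (𝒜 := grading n) J.toIdeal).1 J.isHomogeneous
  obtain ⟨T, hTS, hT⟩ := (Submodule.fg_span_iff_fg_span_finset_subset _).1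
    (hS ▸ IsNoetherian.noetherian J.toIdeal)
  have hom : ∀ f ∈ T, ∃ d, f.IsHomogeneous d := by
    intro f hf
    obtain ⟨g, -, rfl⟩ := hTS hf
    exact g.2
  let e := T.equivFin.symm
  choose D hD using fun k => hom (e k) (e k).2
  refine ⟨T.card, fun k => e k, D, ?_, hD⟩
  rw [hS]
  refine Eq.trans (congrArg Ideal.span ?_) hT.symm
  rw [show (fun k => (e k : MvPolynomial (Fin (n + 1)) ℤ)) = Subtype.val ∘ e from rfl,
    e.surjective.range_comp, Subtype.range_coe_subtype]
  rfl

/-- The arithmetic input. As `F(a)` lies in the `d`-th power of the ideal `(a)`, the norm of that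
power divides the norm of `F(a)`, which is a positive integer because `F(a) ≠ 0`; divisibility then
gives the inequality. -/
theorem mul_log_absNorm_le_sum {K : Type*} [Field K] [NumberField K] {ι : Type*} [Fintype ι]
    {F : MvPolynomial ι ℤ} {d : ℕ} (hF : F.IsHomogeneous d) (a : ι → 𝓞 K)
    (h0 : aeval a F ≠ 0) :
    d * Real.log (Ideal.absNorm (Ideal.span (Set.range a))) ≤
      ∑ σ : K →+* ℂ, Real.log ‖σ (aeval a F : 𝓞 K)‖ := by
  rw [← sum_log_embeddings, ← Real.log_pow]
  have hle : Ideal.span {aeval a F} ≤ Ideal.span (Set.range a) ^ d := by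
    rw [Ideal.span_singleton_le_iff_mem]
    exact aeval_mem_span_pow hF a
  have hdvd := Ideal.absNorm_dvd_absNorm_of_le hle
  rw [map_pow] at hdvd
  have hne : Ideal.absNorm (Ideal.span {aeval a F}) ≠ 0 := by
    simpa [Ideal.absNorm_eq_zero_iff] using h0
  refine Real.log_le_log ?_ (by exact_mod_cast Nat.le_of_dvd (Nat.pos_of_ne_zero hne) hdvd)
  exact_mod_cast Nat.pos_of_ne_zero (ne_zero_of_dvd_ne_zero hne hdvd)

theorem exists_aeval_ne_zero {n : ℕ} {J : HomogeneousIdeal (grading n)} {r : ℕ}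
    {F : Fin r → MvPolynomial (Fin (n + 1)) ℤ} (hF : Ideal.span (Set.range F) = J.toIdeal)
    {k : Type*} [Field k] {v : Fin (n + 1) → k} (h : ∃ f ∈ J, aeval v f ≠ 0) :
    ∃ j, aeval v (F j) ≠ 0 := by
  by_contra! hj
  obtain ⟨f, hf, hf0⟩ := h
  have : J.toIdeal ≤ RingHom.ker (aeval v : MvPolynomial (Fin (n + 1)) ℤ →ₐ[ℤ] k) := by
    rw [← hF, Ideal.span_le]
    rintro _ ⟨j, rfl⟩
    exact hj j
  exact hf0 (this hf)

/-! ### Metrics on the cone over projective space -/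

/-- The norm of the functional on the line through `v` which maps `v` to `1`. -/
noncomputable def HermitianMetric.dualNorm {n : ℕ} {U : Set (Pt ℂ n)} (M : HermitianMetric n U)
    (v : {v : Fin (n + 1) → ℂ // v ≠ 0}) : ℝ :=
  M.fibreNorm (Projectivization.mk ℂ v.1 v.2) (functional v.1 v.2 1)

section Cone

variable {n : ℕ}

/-- The projection `ℂ^{n+1} ∖ {0} → ℙⁿ(ℂ)`. -/
noncomputable def proj (v : {v : Fin (n + 1) → ℂ // v ≠ 0}) : Pt ℂ n := Projectivization.mk ℂ v.1 v.2

theorem continuous_proj : Continuous (proj (n := n)) :=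
  continuous_quotient_mk' (s := projectivizationSetoid ℂ (Fin (n + 1) → ℂ))

theorem exists_rep_proj (v : {v : Fin (n + 1) → ℂ // v ≠ 0}) :
    ∃ c : ℂ, c ≠ 0 ∧ (proj v).rep = c • v.1 := by
  obtain ⟨a, ha⟩ := Projectivization.exists_smul_eq_mk_rep ℂ v.1 v.2
  exact ⟨a, a.ne_zero, ha.symm⟩

theorem affineCoords_proj (i : Fin (n + 1)) (v : {v : Fin (n + 1) → ℂ // v ≠ 0}) :
    affineCoords i (proj v) = (v.1 i)⁻¹ • v.1 := by
  obtain ⟨c, hc, h⟩ := exists_rep_proj v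
  funext j
  simp only [affineCoords, h, Pi.smul_apply, smul_eq_mul]
  rw [mul_div_mul_left _ _ hc, div_eq_inv_mul]

theorem coordSection_proj (i : Fin (n + 1)) (v : {v : Fin (n + 1) → ℂ // v ≠ 0}) :
    coordSection i (proj v) = functional v.1 v.2 (v.1 i) := by
  change coordSection i (Projectivization.mk ℂ v.1 v.2) = _
  refine LinearMap.ext ?_
  rintro ⟨w, hw⟩
  obtain ⟨t, rfl⟩ := Submodule.mem_span_singleton.1 hw
  rw [functional_apply, mul_comm]
  rfl

variable {U : Set (Pt ℂ n)} (M : HermitianMetric n U)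

theorem dualNorm_pos {v : {v : Fin (n + 1) → ℂ // v ≠ 0}} (hv : proj v ∈ U) :
    0 < M.dualNorm v :=
  M.fibreNorm_pos _ hv _ (functional_ne_zero _ _)

theorem fibreNorm_coordSection_proj (i : Fin (n + 1)) {v : {v : Fin (n + 1) → ℂ // v ≠ 0}}
    (hv : proj v ∈ U) :
    M.fibreNorm (proj v) (coordSection i (proj v)) = ‖v.1 i‖ * M.dualNorm v := by
  rw [coordSection_proj, functional_eq_smul]
  exact M.fibreNorm_smul _ hv _ _

theorem log_dualNorm_smul {v w : {v : Fin (n + 1) → ℂ // v ≠ 0}} {l : ℂ} (hl : w.1 = l • v.1)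
    (hw : proj w ∈ U) : Real.log (M.dualNorm w) = Real.log (M.dualNorm v) - Real.log ‖l‖ := by
  have hl0 : l ≠ 0 := fun h => w.2 (by rw [hl, h, zero_smul])
  have h := fibreNorm_functional_smul M v.1 w.1 v.2 w.2 l 1 l hl (mul_one l).symm
  rw [functional_eq_smul] at h
  have h2 : M.dualNorm v = ‖l‖ * M.dualNorm w := h.symm.trans (M.fibreNorm_smul _ hw _ _)
  rw [h2, Real.log_mul (norm_ne_zero_iff.2 hl0) (dualNorm_pos M hw).ne']
  ring

/-- A metric only provides continuity of the norms of the sections `Xᵢ`. Where `vᵢ ≠ 0`, the dual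
norm is `‖Xᵢ‖ / |vᵢ|`, and some such `i` exists near every point of the cone. -/
theorem continuousOn_log_dualNorm :
    ContinuousOn (fun v => Real.log (M.dualNorm v)) (proj ⁻¹' U) := by
  intro v hv
  obtain ⟨i, hi⟩ := Function.ne_iff.1 v.2
  have h1 : ContinuousWithinAt (fun w : {v : Fin (n + 1) → ℂ // v ≠ 0} =>
      M.fibreNorm (proj w) (coordSection i (proj w)) / ‖w.1 i‖) (proj ⁻¹' U) v := by
    refine ContinuousWithinAt.div ?_ ?_ (norm_ne_zero_iff.2 hi)
    · exact ((M.continuousOn_coordSection i).comp continuous_proj.continuousOn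
        (Set.mapsTo_preimage _ _)) v hv
    · exact Continuous.continuousWithinAt ((continuous_apply i).comp continuous_subtype_val).norm
  have hev : ∀ᶠ w : {v : Fin (n + 1) → ℂ // v ≠ 0} in 𝓝[proj ⁻¹' U] v,
      M.fibreNorm (proj w) (coordSection i (proj w)) / ‖w.1 i‖ = M.dualNorm w := by
    have hi' : ∀ᶠ w : {v : Fin (n + 1) → ℂ // v ≠ 0} in 𝓝 v, w.1 i ≠ 0 :=
      (Continuous.continuousAt ((continuous_apply i).comp continuous_subtype_val)).eventually_ne hi
    filter_upwards [self_mem_nhdsWithin, hi'.filter_mono nhdsWithin_le_nhds] with w hw hwi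
    rw [fibreNorm_coordSection_proj M i hw, mul_div_cancel_left₀ _ (norm_ne_zero_iff.2 hwi)]
  have h2 : ContinuousWithinAt M.dualNorm (proj ⁻¹' U) v :=
    h1.congr_of_eventuallyEq (hev.mono fun _ h => h.symm) (hev.self_of_nhdsWithin hv).symm
  exact h2.log (dualNorm_pos M hv).ne'

/-- The points of norm one on the cone over `V₊(I)`. -/
def unitCone (I : HomogeneousIdeal (grading n)) : Set {v : Fin (n + 1) → ℂ // v ≠ 0} :=
  {v | ‖v.1‖ = 1 ∧ proj v ∈ points I ℂ}

theorem continuous_aeval (F : MvPolynomial (Fin (n + 1)) ℤ) :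
    Continuous fun v : Fin (n + 1) → ℂ => aeval v F := by
  simp only [aeval_def, eval₂_eq']
  fun_prop

/-- Membership in `V₊(I)` can be tested on `v` itself, so the cone is cut out of the unit sphere by
polynomial equations. All compactness arguments take place here rather than on `ℙⁿ(ℂ)`. -/
theorem isCompact_unitCone (I : HomogeneousIdeal (grading n)) : IsCompact (unitCone I) := by
  rw [Subtype.isCompact_iff]
  have h : Subtype.val '' unitCone I =
      Metric.sphere 0 1 ∩ ⋂ F ∈ I, {v : Fin (n + 1) → ℂ | aeval v F = 0} := by
    ext v
    simp only [unitCone, proj, mem_points_mk, Set.mem_image, Set.mem_ofPred_eq, Set.mem_inter_iff,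
      mem_sphere_zero_iff_norm, Set.mem_iInter, Subtype.exists, exists_and_right, exists_eq_right]
    refine ⟨fun ⟨⟨_, h⟩, h'⟩ => ⟨h, h'⟩, fun ⟨h, h'⟩ => ⟨⟨?_, h⟩, h'⟩⟩
    rintro rfl
    simp at h
  rw [h]
  exact (isCompact_sphere _ _).inter_right
    (isClosed_biInter fun F _ => isClosed_eq (continuous_aeval F) continuous_const)

end Cone

/-! ### Comparison of the two metrics -/

/-- Taking logarithms turns the exponent `c₂` of a logarithmic singularity into a factor. Replacing
`|t|` by a majorant `Q ≥ 1` first makes a lower bound for `|t|` unnecessary. -/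
theorem abs_log_le_of_max_le {m c₁ c₂ Q t : ℝ} (hm : 0 < m) (hc₁ : 0 < c₁) (hc₂ : 0 < c₂)
    (hQ : 1 ≤ Q) (ht : |t| ≤ Q) (h : max m m⁻¹ ≤ c₁ * |t| ^ c₂) :
    |Real.log m| ≤ |Real.log c₁| + c₂ * Real.log Q := by
  have h1 : max m m⁻¹ ≤ c₁ * Q ^ c₂ := h.trans (by gcongr)
  have hlog : Real.log (c₁ * Q ^ c₂) = Real.log c₁ + c₂ * Real.log Q := by
    rw [Real.log_mul hc₁.ne' (by positivity), Real.log_rpow (by linarith)]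
  have h2 := Real.log_le_log hm ((le_max_left _ _).trans h1)
  have h3 := Real.log_le_log (inv_pos.2 hm) ((le_max_right _ _).trans h1)
  rw [hlog] at h2 h3
  rw [Real.log_inv] at h3
  have := le_abs_self (Real.log c₁)
  exact abs_le.2 ⟨by linarith, by linarith⟩

/-- One nonvanishing generator suffices to control the logarithm of the maximum: it bounds the
maximum from below, while a uniform bound takes care of the other side. -/
theorem abs_log_iSup_le {r : ℕ} {u : Fin r → ℝ} {t B : ℝ} {k : Fin r} (ht : 0 < t) (hk : t ≤ u k)
    (hB : ∀ j, u j ≤ Real.exp B) {Q : ℝ} (hQ : B ≤ Q) (hQ' : -Real.log t ≤ Q) :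
    |Real.log (⨆ j, u j)| ≤ Q := by
  have : Nonempty (Fin r) := ⟨k⟩
  have h1 : t ≤ ⨆ j, u j := hk.trans (le_ciSup (Set.finite_range u).bddAbove k)
  have h2 : ⨆ j, u j ≤ Real.exp B := ciSup_le hB
  have h3 := Real.log_le_log ht h1
  have h4 := Real.log_le_log (ht.trans_le h1) h2
  rw [Real.log_exp] at h4
  exact abs_le.2 ⟨by linarith, by linarith⟩

variable {n : ℕ} {I J : HomogeneousIdeal (grading n)}

theorem exists_norm_aeval_le (I : HomogeneousIdeal (grading n)) {r : ℕ}
    (F : Fin r → MvPolynomial (Fin (n + 1)) ℤ) :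
    ∃ E : ℝ, 0 ≤ E ∧ ∀ v ∈ unitCone I, ∀ k, ‖aeval v.1 (F k)‖ ≤ Real.exp E := by
  choose C hC using fun k => (isCompact_unitCone I).exists_bound_of_continuousOn
    (f := fun v => aeval v.1 (F k))
    ((continuous_aeval (F k)).comp continuous_subtype_val).continuousOn
  refine ⟨∑ k, |C k|, Finset.sum_nonneg fun _ _ => abs_nonneg _, fun v hv k => ?_⟩
  have h1 := Finset.single_le_sum (f := fun k => |C k|) (fun _ _ => abs_nonneg _)
    (Finset.mem_univ k)
  have h2 := Real.add_one_le_exp (∑ k, |C k|)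
  have h3 := hC k v hv
  have h4 := le_abs_self (C k)
  linarith

theorem eventually_abs_le {X : Type*} [TopologicalSpace X] {s : Set X} {f : X → ℝ}
    (hf : ContinuousOn f s) {x : X} (hx : x ∈ s) : ∀ᶠ y in 𝓝 x, y ∈ s → |f y| ≤ |f x| + 1 := by
  rw [← eventually_nhdsWithin_iff]
  filter_upwards [(hf x hx).abs.eventually_lt_const (lt_add_one _)] with y hy using hy.le

/-- In the neighbourhood of a point of `V₊(J)`. -/
theorem exists_local_bound_of_mem
    (M : HermitianMetric n (points I ℂ \ points J ℂ)) (hM : HasLogSingularities I J M)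
    (M₁ : HermitianMetric n (points I ℂ)) {r : ℕ} {F : Fin r → MvPolynomial (Fin (n + 1)) ℤ}
    {D : Fin r → ℕ} (hF : Ideal.span (Set.range F) = J.toIdeal)
    (hD : ∀ k, (F k).IsHomogeneous (D k)) {E : ℝ}
    (hE : ∀ v ∈ unitCone I, ∀ k, ‖aeval v.1 (F k)‖ ≤ Real.exp E)
    {v₀ : {v : Fin (n + 1) → ℂ // v ≠ 0}} (hv₀ : v₀ ∈ unitCone I)
    (hJ : proj v₀ ∈ points J ℂ) :
    ∃ A₀ c : ℝ, 0 < c ∧ ∀ᶠ v in 𝓝 v₀, v ∈ unitCone I → proj v ∉ points J ℂ →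
      ∀ k, aeval v.1 (F k) ≠ 0 → ∀ A, A₀ ≤ A → 1 ≤ A - Real.log ‖aeval v.1 (F k)‖ →
        |Real.log (M.dualNorm v) - Real.log (M₁.dualNorm v)| ≤
          A + c * Real.log (A - Real.log ‖aeval v.1 (F k)‖) := by
  obtain ⟨i, hi⟩ := Function.ne_iff.1 v₀.2
  have hrep : (proj v₀).rep i ≠ 0 := by
    obtain ⟨c, hc, h⟩ := exists_rep_proj v₀
    rw [h]
    exact mul_ne_zero hc hi
  obtain ⟨c₁, c₂, hc₁, hc₂, hev⟩ := hM _ hJ i hrep r F hF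
  have hev' := continuous_proj.continuousAt.eventually hev
  have hcont : Continuous fun v : {v : Fin (n + 1) → ℂ // v ≠ 0} => ‖v.1 i‖ :=
    ((continuous_apply i).comp continuous_subtype_val).norm
  have hpos : 0 < ‖v₀.1 i‖ := norm_pos_iff.2 hi
  -- Near `v₀` one has `b < |vᵢ| ≤ 1`, so passing between `v` and its affine coordinates changes
  -- every `|F_j|` by a factor between `1` and `exp (S * |log b|)`.
  set b : ℝ := ‖v₀.1 i‖ / 2 with hb
  have hb0 : 0 < b := by positivity
  have hlow : ∀ᶠ v : {v : Fin (n + 1) → ℂ // v ≠ 0} in 𝓝 v₀, b < ‖v.1 i‖ :=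
    hcont.continuousAt.eventually_const_lt (half_lt_self hpos)
  have hM₁ := eventually_abs_le (continuousOn_log_dualNorm M₁) (x := v₀) hv₀.2
  set B₁ : ℝ := |Real.log (M₁.dualNorm v₀)| + 1
  set S : ℕ := ∑ k, D k
  set B : ℝ := E + S * |Real.log b| with hB
  -- Since `log |F_k(v)| ≤ E`, the terms `|B| + |E|` make `A - log |F_k(v)|` at least `B`. The
  -- others absorb `c₁`, the passage from `‖Xᵢ‖` to the dual norm, and the metric `M₁`.
  refine ⟨|B| + |E| + |Real.log c₁| + |Real.log b| + B₁, c₂, hc₂, ?_⟩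
  filter_upwards [hev', hlow, hM₁] with v h1 h2 h3 hv hvJ k hk A hA hQ
  have hvU : proj v ∈ points I ℂ \ points J ℂ := ⟨hv.2, hvJ⟩
  have hi0 : 0 < ‖v.1 i‖ := hb0.trans h2
  have hi1 : ‖v.1 i‖ ≤ 1 := hv.1 ▸ norm_le_pi_norm v.1 i
  have hm : 0 < ‖v.1 i‖ * M.dualNorm v := mul_pos hi0 (dualNorm_pos M hvU)
  have hlogi : |Real.log ‖v.1 i‖| ≤ |Real.log b| := by
    have l1 := Real.log_le_log hb0 h2.le
    have l2 := Real.log_nonpos hi0.le hi1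
    rw [abs_of_nonpos l2, abs_of_nonpos (l1.trans l2)]
    linarith
  have haff : ∀ j, ‖aeval (affineCoords i (proj v)) (F j)‖ =
      (‖v.1 i‖ ^ D j)⁻¹ * ‖aeval v.1 (F j)‖ := fun j => by
    rw [affineCoords_proj, aeval_smul_of_isHomogeneous (hD j), norm_mul, norm_pow, norm_inv,
      inv_pow]
  have h4 := h1 hvU
  rw [fibreNorm_coordSection_proj M i hvU] at h4
  have hlogk : Real.log ‖aeval v.1 (F k)‖ ≤ E := by
    have := Real.log_le_log (norm_pos_iff.2 hk) (hE v hv k)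
    rwa [Real.log_exp] at this
  have e1 := abs_nonneg B
  have e2 := le_abs_self B
  have e3 := abs_nonneg E
  have e4 := le_abs_self E
  have e5 := abs_nonneg (Real.log c₁)
  have e6 := abs_nonneg (Real.log b)
  have h3' := h3 hv.2
  have e7 := (abs_nonneg _).trans h3'
  have h5 : |Real.log (⨆ j, ‖aeval (affineCoords i (proj v)) (F j)‖)| ≤
      A - Real.log ‖aeval v.1 (F k)‖ := by
    refine abs_log_iSup_le (t := ‖aeval v.1 (F k)‖) (B := B) (k := k) (norm_pos_iff.2 hk) ?_ ?_
      (by linarith) (by linarith)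
    · rw [haff]
      refine le_mul_of_one_le_left (norm_nonneg _) ?_
      exact (one_le_inv₀ (by positivity)).2 (pow_le_one₀ hi0.le hi1)
    · intro j
      rw [haff, hB, add_comm E, Real.exp_add]
      refine mul_le_mul ?_ (hE v hv j) (norm_nonneg _) (Real.exp_nonneg _)
      rw [← Real.log_le_log_iff (by positivity) (Real.exp_pos _), Real.log_exp, Real.log_inv,
        Real.log_pow]
      have d1 : (D j : ℝ) ≤ S := by
        exact_mod_cast Finset.single_le_sum (f := D) (fun _ _ => Nat.zero_le _)
          (Finset.mem_univ j)
      have d2 : -Real.log ‖v.1 i‖ ≤ |Real.log b| := (neg_le_abs _).trans hlogi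
      have d3 : (0 : ℝ) ≤ D j := Nat.cast_nonneg _
      nlinarith [mul_le_mul_of_nonneg_left d2 d3, mul_le_mul_of_nonneg_right d1 e6]
  have h6 := abs_log_le_of_max_le hm hc₁ hc₂ hQ h5 h4
  rw [Real.log_mul hi0.ne' (dualNorm_pos M hvU).ne'] at h6
  rw [abs_le] at h6 h3' hlogi ⊢
  constructor <;> linarith [h6.1, h6.2, h3'.1, h3'.2, hlogi.1, hlogi.2]

/-- Local bounds are glued by compactness of the unit cone. Near `Y` they come from the logarithmic
singularities, elsewhere from continuity of both metrics. -/
theorem exists_log_bound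
    (M : HermitianMetric n (points I ℂ \ points J ℂ)) (hM : HasLogSingularities I J M)
    (M₁ : HermitianMetric n (points I ℂ)) {r : ℕ} {F : Fin r → MvPolynomial (Fin (n + 1)) ℤ}
    {D : Fin r → ℕ} (hF : Ideal.span (Set.range F) = J.toIdeal)
    (hD : ∀ k, (F k).IsHomogeneous (D k)) :
    ∃ A c : ℝ, 0 < A ∧ 0 < c ∧ ∀ v ∈ unitCone I, proj v ∉ points J ℂ →
      ∀ k, aeval v.1 (F k) ≠ 0 → 1 ≤ A - Real.log ‖aeval v.1 (F k)‖ ∧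
        |Real.log (M.dualNorm v) - Real.log (M₁.dualNorm v)| ≤
          A + c * Real.log (A - Real.log ‖aeval v.1 (F k)‖) := by
  obtain ⟨E, hE0, hE⟩ := exists_norm_aeval_le I F
  have hQ : ∀ v ∈ unitCone I, ∀ k, aeval v.1 (F k) ≠ 0 → ∀ A, E + 1 ≤ A →
      1 ≤ A - Real.log ‖aeval v.1 (F k)‖ := by
    intro v hv k hk A hA
    have := Real.log_le_log (norm_pos_iff.2 hk) (hE v hv k)
    rw [Real.log_exp] at this
    linarith
  -- Allowing every `A ≥ A₀` lets two bounds be merged by taking maxima; the condition `1 ≤ A - log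
  -- |F_k(v)|` makes the logarithm nonnegative, so that `c` may be enlarged too. The membership in
  -- the cone is repeated because the induction runs over arbitrary sets.
  have key : ∃ A₀ c : ℝ, 0 < c ∧ ∀ v ∈ unitCone I, v ∈ unitCone I → proj v ∉ points J ℂ →
      ∀ k, aeval v.1 (F k) ≠ 0 → ∀ A, A₀ ≤ A → 1 ≤ A - Real.log ‖aeval v.1 (F k)‖ →
        |Real.log (M.dualNorm v) - Real.log (M₁.dualNorm v)| ≤
          A + c * Real.log (A - Real.log ‖aeval v.1 (F k)‖) := by
    refine (isCompact_unitCone I).induction_on (p := fun S => ∃ A₀ c : ℝ, 0 < c ∧ ∀ v ∈ S,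
      v ∈ unitCone I → proj v ∉ points J ℂ → ∀ k, aeval v.1 (F k) ≠ 0 → ∀ A, A₀ ≤ A →
        1 ≤ A - Real.log ‖aeval v.1 (F k)‖ →
        |Real.log (M.dualNorm v) - Real.log (M₁.dualNorm v)| ≤
          A + c * Real.log (A - Real.log ‖aeval v.1 (F k)‖)) ?_ ?_ ?_ ?_
    · exact ⟨0, 1, one_pos, fun v hv => hv.elim⟩
    · rintro S T hST ⟨A₀, c, hc, h⟩
      exact ⟨A₀, c, hc, fun v hv => h v (hST hv)⟩
    · rintro S T ⟨A₀, c, hc, h⟩ ⟨A₀', c', hc', h'⟩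
      refine ⟨max A₀ A₀', max c c', lt_max_of_lt_left hc, ?_⟩
      rintro v (hv | hv) hvI hvJ k hk A hA hQA
      · refine (h v hv hvI hvJ k hk A ((le_max_left _ _).trans hA) hQA).trans ?_
        have := Real.log_nonneg hQA
        gcongr
        exact le_max_left _ _
      · refine (h' v hv hvI hvJ k hk A ((le_max_right _ _).trans hA) hQA).trans ?_
        have := Real.log_nonneg hQA
        gcongr
        exact le_max_right _ _
    · intro v₀ hv₀
      by_cases hJ : proj v₀ ∈ points J ℂ
      · obtain ⟨A₀, c, hc, h⟩ := exists_local_bound_of_mem M hM M₁ hF hD hE hv₀ hJ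
        exact ⟨_, mem_nhdsWithin_of_mem_nhds h, A₀, c, hc, fun v hv => hv⟩
      · have hf := (continuousOn_log_dualNorm M).sub
          ((continuousOn_log_dualNorm M₁).mono (Set.preimage_mono Set.sdiff_subset))
        refine ⟨_, mem_nhdsWithin_of_mem_nhds (eventually_abs_le hf (x := v₀) ⟨hv₀.2, hJ⟩),
          |Real.log (M.dualNorm v₀) - Real.log (M₁.dualNorm v₀)| + 1, 1, one_pos, fun v hv hvI hvJ k hk A hA hQA => ?_⟩
        refine ((hv ⟨hvI.2, hvJ⟩).trans hA).trans ?_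
        linarith [Real.log_nonneg hQA]
  obtain ⟨A₀, c, hc, h⟩ := key
  -- `E + 1` guarantees `1 ≤ A - log |F_k(v)|` on the whole cone.
  refine ⟨max A₀ (E + 1), c, lt_max_of_lt_right (by linarith), hc, fun v hv hvJ k hk => ?_⟩
  have := hQ v hv k hk _ (le_max_right A₀ (E + 1))
  exact ⟨this, h v hv hv hvJ k hk _ (le_max_left _ _) this⟩

/-! ### Comparison of the heights -/

/-- Jensen's inequality for the concave function `log` with equal weights. -/
theorem sum_log_div_card_le {ι : Type*} [Fintype ι] [Nonempty ι] {f : ι → ℝ}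
    (hf : ∀ i, 0 < f i) :
    (Fintype.card ι : ℝ)⁻¹ * ∑ i, Real.log (f i) ≤
      Real.log ((Fintype.card ι : ℝ)⁻¹ * ∑ i, f i) := by
  have h := strictConcaveOn_log_Ioi.concaveOn.le_map_sum (t := Finset.univ)
    (w := fun _ : ι => (Fintype.card ι : ℝ)⁻¹) (p := f) (fun _ _ => by positivity)
    (by simp) (fun i _ => hf i)
  simpa [Finset.mul_sum] using h

theorem exists_unitCone_smul {K : Type*} [Field K] (z : Fin (n + 1) → K) (hz : z ≠ 0)
    (σ : K →+* ℂ) (hσ : conj z hz σ ∈ points I ℂ) :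
    ∃ v ∈ unitCone I, ∃ s : ℝ, 0 < s ∧ (σ ∘ z = (s : ℂ) • v.1) ∧ proj v = conj z hz σ := by
  have h0 : σ ∘ z ≠ 0 := fun h => hz (funext fun i => σ.injective (by simpa using congrFun h i))
  have hs : 0 < ‖σ ∘ z‖ := norm_pos_iff.2 h0
  have hs' : ((‖σ ∘ z‖ : ℝ) : ℂ) ≠ 0 := by exact_mod_cast hs.ne'
  have hv : ((‖σ ∘ z‖ : ℝ) : ℂ)⁻¹ • (σ ∘ z) ≠ 0 := smul_ne_zero (inv_ne_zero hs') h0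
  have hp : proj ⟨_, hv⟩ = conj z hz σ := (Projectivization.mk_eq_mk_iff' ℂ _ _ _ _).2 ⟨_, rfl⟩
  refine ⟨⟨_, hv⟩, ⟨?_, hp ▸ hσ⟩, _, hs, (smul_inv_smul₀ hs' _).symm, hp⟩
  rw [norm_smul, norm_inv, Complex.norm_real, norm_norm, inv_mul_cancel₀ hs.ne']

/-- The estimate over a fixed number field, for one form `F` with `F(x) ≠ 0`: the local bounds are
averaged over the embeddings and the mean of `-log |F(v_σ)|` is controlled by `h₁`. The first
conclusion keeps the final logarithm meaningful, since `h₁` may be negative. -/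
theorem abs_heightOver_sub_le
    (M : HermitianMetric n (points I ℂ \ points J ℂ)) (M₁ : HermitianMetric n (points I ℂ))
    {F : MvPolynomial (Fin (n + 1)) ℤ} {D : ℕ} (hD : F.IsHomogeneous D) {A c C : ℝ} (hc : 0 < c)
    (hA : ∀ v ∈ unitCone I, proj v ∉ points J ℂ → aeval v.1 F ≠ 0 →
      1 ≤ A - Real.log ‖aeval v.1 F‖ ∧
        |Real.log (M.dualNorm v) - Real.log (M₁.dualNorm v)| ≤
          A + c * Real.log (A - Real.log ‖aeval v.1 F‖))
    (hC : ∀ v ∈ unitCone I, |Real.log (M₁.dualNorm v)| ≤ C)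
    {K : Type*} [Field K] [NumberField K] (z : Fin (n + 1) → K) (hz : z ≠ 0)
    (hU : ∀ σ, conj z hz σ ∈ points I ℂ \ points J ℂ) (hF : aeval z F ≠ 0)
    (p : K) (hp : p ∈ pullback z) (hp0 : p ≠ 0) :
    1 ≤ A + D * (heightOver M₁ z hz p + C) ∧
    |heightOver M z hz p - heightOver M₁ z hz p| ≤
      A + c * Real.log (A + D * (heightOver M₁ z hz p + C)) := by
  obtain ⟨m, a, hm, ha⟩ := exists_integral_multiple z
  choose v hv s hs hsv hproj using fun σ => exists_unitCone_smul z hz σ (hU σ).1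
  have hnorm : ∀ (U : Set (Pt ℂ n)) (N : HermitianMetric n U), (∀ σ, conj z hz σ ∈ U) → ∀ σ,
      Real.log (pullbackNorm N z hz σ 1) = Real.log (N.dualNorm (v σ)) - Real.log (s σ) := by
    intro U N hN σ
    have h0 : σ ∘ z ≠ 0 := fun h =>
      hz (funext fun i => σ.injective (by simpa using congrFun h i))
    have h := log_dualNorm_smul N (v := v σ) (w := ⟨σ ∘ z, h0⟩) (hsv σ) (hN σ)
    rw [Complex.norm_real, Real.norm_of_nonneg (hs σ).le] at h
    rw [← h, pullbackNorm, map_one]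
    rfl
  have hFv : ∀ σ, σ (aeval z F) = (s σ : ℂ) ^ D * aeval (v σ).1 F := fun σ => by
    rw [← aeval_comp_ringHom, hsv, aeval_smul_of_isHomogeneous hD]
  have hFv0 : ∀ σ, aeval (v σ).1 F ≠ 0 := fun σ h => by
    have := hFv σ
    rw [h, mul_zero, map_eq_zero] at this
    exact hF this
  have hAσ := fun σ => hA (v σ) (hv σ) (hproj σ ▸ (hU σ).2) (hFv0 σ)
  have haF : ((aeval a F : 𝓞 K) : K) = (m : K) ^ D * aeval z F := by
    rw [← aeval_smul_of_isHomogeneous hD]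
    refine (aeval_comp_ringHom (algebraMap (𝓞 K) K) a F).symm.trans ?_
    congr 2
    funext i
    exact ha i
  have hmK : (m : K) ≠ 0 := by simpa using hm
  have haF0 : aeval a F ≠ 0 := fun h => by
    rw [h] at haF
    exact mul_ne_zero (pow_ne_zero _ hmK) hF (haF.symm.trans (map_zero _))
  have hlog : ∀ σ : K →+* ℂ, Real.log ‖σ (aeval a F : 𝓞 K)‖ =
      D * Real.log ‖σ m‖ + D * Real.log (s σ) + Real.log ‖aeval (v σ).1 F‖ := fun σ => by
    rw [haF, map_mul, hFv, map_pow, norm_mul, norm_mul, norm_pow, norm_pow, Complex.norm_real,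
      Real.norm_of_nonneg (hs σ).le, Real.log_mul, Real.log_mul, Real.log_pow, Real.log_pow]
    · ring
    · exact pow_ne_zero _ (hs σ).ne'
    · exact norm_ne_zero_iff.2 (hFv0 σ)
    · exact pow_ne_zero _ (norm_ne_zero_iff.2 ((map_ne_zero σ).2 hmK))
    · exact mul_ne_zero (pow_ne_zero _ (hs σ).ne') (norm_ne_zero_iff.2 (hFv0 σ))
  have harith := mul_log_absNorm_le_sum hD a haF0
  simp only [hlog, Finset.sum_add_distrib, ← Finset.mul_sum] at harith
  have f := heightOver_formula M z hz hU a m hm ha p hp hp0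
  have f₁ := heightOver_formula M₁ z hz (fun σ => (hU σ).1) a m hm ha p hp hp0
  simp only [hnorm _ M hU, Finset.sum_sub_distrib] at f
  simp only [hnorm _ M₁ fun σ => (hU σ).1, Finset.sum_sub_distrib] at f₁
  have hcard : (Fintype.card (K →+* ℂ) : ℝ) = Module.finrank ℚ K := by
    exact_mod_cast NumberField.Embeddings.card K ℂ
  rw [← hcard] at f f₁
  set d : ℝ := (Fintype.card (K →+* ℂ) : ℝ) with hd
  have hd0 : 0 < d := by
    rw [hcard]
    exact_mod_cast Module.finrank_pos
  have hne : Nonempty (K →+* ℂ) := Fintype.card_pos_iff.1 (Nat.cast_pos.1 hd0)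
  set h := heightOver M z hz p
  set h₁ := heightOver M₁ z hz p
  have hCsum : ∑ σ, Real.log (M₁.dualNorm (v σ)) ≤ d * C := by
    refine (Finset.sum_le_card_nsmul _ _ C fun σ _ =>
      (le_abs_self _).trans (hC _ (hv σ))).trans_eq ?_
    rw [nsmul_eq_mul, Finset.card_univ]
  -- In `harith - D * f₁` the contributions of `m`, of the ideal norm and of the scalars `s σ`
  -- cancel, leaving only `F(v_σ)` and the dual norms of `M₁`, which `C` bounds.
  have hQsum : d⁻¹ * ∑ σ, (A - Real.log ‖aeval (v σ).1 F‖) ≤ A + D * (h₁ + C) := by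
    rw [Finset.sum_sub_distrib, Finset.sum_const, Finset.card_univ, nsmul_eq_mul, ← hd,
      inv_mul_le_iff₀ hd0]
    rw [eq_inv_mul_iff_mul_eq₀ hd0.ne'] at f₁
    have := mul_le_mul_of_nonneg_left hCsum (Nat.cast_nonneg (α := ℝ) D)
    linear_combination harith - (D : ℝ) * f₁ + this
  have hQ1 : 1 ≤ d⁻¹ * ∑ σ, (A - Real.log ‖aeval (v σ).1 F‖) := by
    rw [le_inv_mul_iff₀ hd0, mul_one]
    have := Finset.card_nsmul_le_sum Finset.univ
      (fun σ => A - Real.log ‖aeval (v σ).1 F‖) 1 fun σ _ => (hAσ σ).1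
    simpa [hd] using this
  refine ⟨hQ1.trans hQsum, ?_⟩
  -- Both heights are computed with the same `m`, `a` and `s σ`, so only the dual norms survive.
  have hdiff : h - h₁ =
      -(d⁻¹ * ∑ σ, (Real.log (M.dualNorm (v σ)) - Real.log (M₁.dualNorm (v σ)))) := by
    rw [f, f₁, Finset.sum_sub_distrib]
    ring
  rw [hdiff, abs_neg, abs_mul, abs_of_pos (inv_pos.2 hd0)]
  calc d⁻¹ * |∑ σ, (Real.log (M.dualNorm (v σ)) - Real.log (M₁.dualNorm (v σ)))|
      ≤ d⁻¹ * ∑ σ, (A + c * Real.log (A - Real.log ‖aeval (v σ).1 F‖)) := by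
        gcongr
        exact (Finset.abs_sum_le_sum_abs _ _).trans (Finset.sum_le_sum fun σ _ => (hAσ σ).2)
    _ = A + c * (d⁻¹ * ∑ σ, Real.log (A - Real.log ‖aeval (v σ).1 F‖)) := by
        rw [Finset.sum_add_distrib, Finset.sum_const, Finset.card_univ, nsmul_eq_mul, ← hd,
          ← Finset.mul_sum]
        field_simp
    _ ≤ A + c * Real.log (A + D * (h₁ + C)) := by
        gcongr
        refine (sum_log_div_card_le fun σ => one_pos.trans_le (hAσ σ).1).trans ?_
        exact Real.log_le_log (one_pos.trans_le hQ1) hQsum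

end LogHeight

/-! ### Constants uniform in the point and in the generator -/

theorem mainTheorem4 (n : ℕ) (I J : HomogeneousIdeal (LogHeight.grading n)) (hIJ : I ≤ J)
    (M : LogHeight.HermitianMetric n (LogHeight.points I ℂ \ LogHeight.points J ℂ))
    (hM : LogHeight.HasLogSingularities I J M)
    (M₁ : LogHeight.HermitianMetric n (LogHeight.points I ℂ)) :
    ∃ c₃ c₄ : ℝ, 0 < c₃ ∧ 0 < c₄ ∧
      ∀ x ∈ LogHeight.points I LogHeight.QBar \ LogHeight.points J LogHeight.QBar,
        |M.height x - M₁.height x| ≤ c₃ + c₄ * Real.log (max 1 (M₁.height x)) := by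
  open LogHeight in
  obtain ⟨r, F, D, hF, hD⟩ := exists_homogeneous_generators J
  obtain ⟨A, c, hA0, hc, hA⟩ := exists_log_bound M hM M₁ hF hD
  obtain ⟨C, hC⟩ := (isCompact_unitCone I).exists_bound_of_continuousOn
    ((continuousOn_log_dualNorm M₁).mono fun v hv => hv.2)
  set S : ℕ := ∑ k, D k
  have hS : (0 : ℝ) ≤ S := Nat.cast_nonneg _
  have hC0 := abs_nonneg C
  -- The generator `F_k` depends on `x`, but `S` dominates all degrees. With `H = max 1 (h₁ x)`,
  -- this `B` satisfies `A + D k * (h₁ x + |C|) ≤ B * H`, and `log (B * H) = log B + log H` yields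
  -- `c₃` and `c₄`.
  set B : ℝ := 1 + A + S * (1 + |C|) with hB
  have hB1 : 1 ≤ B := by nlinarith
  refine ⟨A + c * Real.log B, c, add_pos_of_pos_of_nonneg hA0
    (mul_nonneg hc.le (Real.log_nonneg hB1)), hc, fun x hx => ?_⟩
  have hU : ∀ σ, conj (coords x) (coords_ne_zero x) σ ∈ points I ℂ \ points J ℂ := fun σ =>
    ⟨(conj_coords_mem_points I x σ).2 hx.1, fun h => hx.2 ((conj_coords_mem_points J x σ).1 h)⟩
  obtain ⟨k, hk⟩ : ∃ k, aeval (coords x) (F k) ≠ 0 := by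
    refine exists_aeval_ne_zero hF ?_
    by_contra! h
    refine hx.2 fun f hf => ?_
    have := aeval_comp_ringHom (coordField x).val.toRingHom (coords x) f
    rw [h f hf, map_zero] at this
    exact this
  obtain ⟨h1, h2⟩ := abs_heightOver_sub_le M M₁ (hD k) hc (fun v hv hvJ => hA v hv hvJ k)
    (fun v hv => (hC v hv).trans (le_abs_self C)) (coords x) (coords_ne_zero x) hU hk
    (nonzeroCoord x) (Submodule.subset_span ⟨_, rfl⟩)
    (Function.ne_iff.mp (coords_ne_zero x)).choose_spec
  change 1 ≤ A + D k * (M₁.height x + |C|) at h1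
  change |M.height x - M₁.height x| ≤ A + c * Real.log (A + D k * (M₁.height x + |C|)) at h2
  refine h2.trans ?_
  set H := max 1 (M₁.height x)
  have hH1 : 1 ≤ H := le_max_left _ _
  have hH : M₁.height x ≤ H := le_max_right _ _
  have hDk : (D k : ℝ) ≤ S := by
    exact_mod_cast Finset.single_le_sum (f := D) (fun _ _ => Nat.zero_le _) (Finset.mem_univ k)
  have hle : A + D k * (M₁.height x + |C|) ≤ B * H := by
    have g1 : D k * (M₁.height x + |C|) ≤ S * ((1 + |C|) * H) := by
      refine (mul_le_mul_of_nonneg_left (c := (1 + |C|) * H) ?_ (Nat.cast_nonneg _)).trans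
        (mul_le_mul_of_nonneg_right hDk (by positivity))
      nlinarith
    nlinarith
  have := Real.log_le_log (one_pos.trans_le h1) hle
  rw [Real.log_mul (by linarith) (by linarith)] at this
  nlinarith
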